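/- Let $d\ge 1$, let $\mathcal D\subset\mathbb R^d$ be an open convex polytope, and let $(\mathcal T_h)_h$ be a family of matching meshes of $\mathcal D$: each $\mathcal T_h$ consists of finitely many (closed, full-dimensional) convex polytopes $T$ with pairwise disjoint interiors and union $\overline{\mathcal D}$, and every facet $e$ of an element either lies on $\partial\mathcal D$ (and belongs to one element $T_e$) or is a common facet of exactly two elements $T_e^+,T_e^-$. Let $F_h$ be the set of all facets and $h_T$ the diameter of $T$; put $h_e=\min(h_{T_e^+},h_{T_e^-})$ on interior facets and $h_e=h_{T_e}$ on boundary facets; let $n_0$ be the maximal number of facets of an element of $\mathcal T_h$. The family is shape regular: there is $\rho>0$ such that every $T\in\mathcal T_h$, for every $h$, contains a ball of radius $\rho h_T$. Let $K$ be a Lipschitz continuous function on $\mathcal D$ (extended continuously to $\overline{\mathcal D}$) with values in the symmetric $d\times d$ matrices, whose eigenvalues lie in $[K_0,K_1]$ for almost every $x\in\mathcal D$, where $K_0,K_1>0$. Let $\chi_1,\chi_2\in W^{1,\infty}(\mathcal D)$ be non-negative with $\chi_1+\chi_2=1$ and affine on every $T\in\mathcal T_h$. Let $V_h=\{v\in L^2(\mathcal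 D): v|_T\in\mathbb P^1(T)\ \forall T\in\mathcal T_h\}$. On an interior facet let $[v]=v|_{T_e^+}-v|_{T_e^-}$, $\{v\}=\tfrac12(v|_{T_e^+}+v|_{T_e^-})$ and let $\mathbf n_e$ be the unit outward normal of $T_e^+$; on a boundary facet let $[v]=\{v\}=v|_{T_e}$ and let $\mathbf n_e$ be the unit outward normal of $T_e$. For $\sigma\in\mathbb R$ and $\ell\in\{1,2\}$ let $A_{h,\ell}:V_h\to V_h$ be the linear operator with $(A_{h,\ell}v_h,w_h)_{L^2(\mathcal D)}=a_{h,\ell}(v_h,w_h)$ for all $v_h,w_h\in V_h$, where $$a_{h,\ell}(v_h,w_h)=\sum_{T\in\mathcal T_h}(\chi_\ell K\nabla v_h,\nabla w_h)_{L^2(T)^d}-\sum_{e\in F_h}\int_e\{\chi_\ell K\nabla v_h\cdot\mathbf n_e\}[w_h]\,d\xi-\sum_{e\in F_h}\int_e\{\chi_\ell K\nabla w_h\cdot\mathbf n_e\}[v_h]\,d\xi+\sum_{e\in F_h}\int_e\chi_\ell\frac{\sigma}{h_e}[v_h][w_h]\,d\xi .$$ Call $C_\chi>0$ a trace constant of $\mathcal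 T_h$ if $\|p\|_{L^1(e)}\le C_\chi h_T^{-1}\|p\|_{L^1(T)}$ for every $T\in\mathcal T_h$, every facet $e$ of $T$ and every polynomial $p$ of degree at most $1$. Then there is a $C_\chi$ that is a trace constant of $\mathcal T_h$ for every $h$. Moreover, for every $h$ and every trace constant $C_\chi$ of $\mathcal T_h$: if $\sigma\ge C_\chi K_1^2K_0^{-1}n_0$, then for $\ell\in\{1,2\}$ the operator $A_{h,\ell}$ exists, is unique, and is non-negative on $V_h$ with respect to the $L^2(\mathcal D)$ inner product, i.e. $(A_{h,\ell}v_h,v_h)_{L^2(\mathcal D)}\ge 0$ for all $v_h\in V_h$. -/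

import Mathlib

open MeasureTheory Set
open scoped RealInnerProductSpace

noncomputable section

namespace SplitDG

/-- The Euclidean space `ℝ^d`. -/
abbrev E (d : ℕ) : Type := EuclideanSpace ℝ (Fin d)

/-- The gradient of an affine function `ℝ^d → ℝ`, i.e. of a polynomial of degree at most one
(a constant vector). -/
def grad {d : ℕ} (p : E d →ᵃ[ℝ] ℝ) : E d :=
  (InnerProductSpace.toDual ℝ (E d)).symm (LinearMap.toContinuousLinearMap p.linear)

/-- A full-dimensional convex polytope in `ℝ^d`, presented as a bounded intersection of finitely
many half-spaces `{x | ⟪nⱼ, x⟫ ≤ bⱼ}` with unit outward normals `nⱼ`. By `irredundant` every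
inequality defines a facet, and different inequalities define different facets; thus `numFaces` is
the number of facets (faces of dimension `d - 1`) of the polytope. -/
structure ConvexPolytope (d : ℕ) where
  numFaces : ℕ
  normal : Fin numFaces → E d
  offset : Fin numFaces → ℝ
  norm_normal : ∀ j, ‖normal j‖ = 1
  isBounded : Bornology.IsBounded {x : E d | ∀ j, ⟪normal j, x⟫ ≤ offset j}
  interior_nonempty : (interior {x : E d | ∀ j, ⟪normal j, x⟫ ≤ offset j}).Nonempty
  irredundant : ∀ j, ∃ x : E d, ⟪normal j, x⟫ = offset j ∧ ∀ k, k ≠ j → ⟪normal k, x⟫ < offset k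

/-- The (closed) point set of a polytope. -/
def ConvexPolytope.carrier {d : ℕ} (T : ConvexPolytope d) : Set (E d) :=
  {x | ∀ j, ⟪T.normal j, x⟫ ≤ T.offset j}

/-- The `j`-th facet of a polytope. -/
def ConvexPolytope.face {d : ℕ} (T : ConvexPolytope d) (j : Fin T.numFaces) : Set (E d) :=
  {x | x ∈ T.carrier ∧ ⟪T.normal j, x⟫ = T.offset j}

/-- The diameter `h_T` of an element. -/
def ConvexPolytope.diam {d : ℕ} (T : ConvexPolytope d) : ℝ := Metric.diam T.carrier

/-- A matching polytopal mesh of a domain `D`: finitely many convex polytopes with pairwise disjoint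
interiors that cover the closure of `D`. Every facet of an element is either shared by
exactly two elements (an interior face, with an arbitrary but fixed choice of the
elements `T⁺` and `T⁻`), or it lies on the boundary of `D` (a boundary face). Each pair
(element, facet of that element) occurs exactly once in this enumeration. -/
structure Mesh {d : ℕ} (D : Set (E d)) where
  numElem : ℕ
  elem : Fin numElem → ConvexPolytope d
  cover : closure D = ⋃ i, (elem i).carrier
  disjoint_interior :
    Pairwise fun i j => Disjoint (interior (elem i).carrier) (interior (elem j).carrier)
  numInt : ℕ
  numBdry : ℕ
  plus : Fin numInt → Σ i, Fin (elem i).numFaces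
  minus : Fin numInt → Σ i, Fin (elem i).numFaces
  bdry : Fin numBdry → Σ i, Fin (elem i).numFaces
  enum_bijective : Function.Bijective (Sum.elim plus (Sum.elim minus bdry))
  plus_elem_ne : ∀ a, (plus a).1 ≠ (minus a).1
  plus_face_eq : ∀ a,
    (elem (plus a).1).face (plus a).2 = (elem (minus a).1).face (minus a).2
  bdry_subset : ∀ b, (elem (bdry b).1).face (bdry b).2 ⊆ frontier D

namespace Mesh

variable {d : ℕ} {D : Set (E d)}

/-- The set `F_h` of all faces of the mesh, each counted once: interior and boundary faces. -/
abbrev Face (M : Mesh D) : Type := Fin M.numInt ⊕ Fin M.numBdry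

/-- The point set of a face. -/
def faceSet (M : Mesh D) : M.Face → Set (E d) :=
  Sum.elim (fun a => (M.elem (M.plus a).1).face (M.plus a).2)
    (fun b => (M.elem (M.bdry b).1).face (M.bdry b).2)

/-- The unit normal `n_e`: the outward normal of `T⁺` on an interior face, and the outward normal
of the only adjacent element on a boundary face. -/
def faceNormal (M : Mesh D) : M.Face → E d :=
  Sum.elim (fun a => (M.elem (M.plus a).1).normal (M.plus a).2)
    (fun b => (M.elem (M.bdry b).1).normal (M.bdry b).2)

/-- The local size `h_e = min (h_{T⁺}, h_{T⁻})`, respectively `h_e = h_T` on the boundary. -/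
def faceDiam (M : Mesh D) : M.Face → ℝ :=
  Sum.elim (fun a => min (M.elem (M.plus a).1).diam (M.elem (M.minus a).1).diam)
    (fun b => (M.elem (M.bdry b).1).diam)

/-- The maximal number `n₀` of faces of an element. -/
def maxFaces (M : Mesh D) : ℕ := Finset.univ.sup fun i => (M.elem i).numFaces

/-- The space `V_h` of all `v ∈ L²(D)` that agree (almost everywhere) on every element with a
polynomial of degree at most one. -/
def Vh (M : Mesh D) : Submodule ℝ (Lp ℝ 2 (volume.restrict D)) where
  carrier := {v | ∀ i, ∃ p : E d →ᵃ[ℝ] ℝ,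
    (v : E d → ℝ) =ᵐ[volume.restrict (D ∩ (M.elem i).carrier)] p}
  zero_mem' := fun i => ⟨0, by
    have h := Lp.coeFn_zero ℝ 2 (volume.restrict D)
    filter_upwards [ae_mono (Measure.restrict_mono inter_subset_left le_rfl) h] with x hx
    simpa using hx⟩
  add_mem' := by
    intro v w hv hw i
    obtain ⟨p, hp⟩ := hv i
    obtain ⟨q, hq⟩ := hw i
    refine ⟨p + q, ?_⟩
    filter_upwards [hp, hq,
      ae_mono (Measure.restrict_mono inter_subset_left le_rfl) (Lp.coeFn_add v w)] with x h1 h2 h3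
    rw [h3, Pi.add_apply, h1, h2, AffineMap.coe_add, Pi.add_apply]
  smul_mem' := by
    intro c v hv i
    obtain ⟨p, hp⟩ := hv i
    refine ⟨c • p, ?_⟩
    filter_upwards [hp,
      ae_mono (Measure.restrict_mono inter_subset_left le_rfl) (Lp.coeFn_smul c v)] with x h1 h2
    rw [h2, Pi.smul_apply, h1, AffineMap.coe_smul, Pi.smul_apply]

/-- The polynomial `v_h|_T` that represents `v_h ∈ V_h` on the element `T = T_i`. For an open
convex domain it is unique, because `D ∩ T` then has interior points. -/
def localPoly (M : Mesh D) (v : M.Vh) (i : Fin M.numElem) : E d →ᵃ[ℝ] ℝ := (v.2 i).choose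

/-- The jump `[v_h]` on a face. -/
def jump (M : Mesh D) (v : M.Vh) : M.Face → E d → ℝ :=
  Sum.elim (fun a x => M.localPoly v (M.plus a).1 x - M.localPoly v (M.minus a).1 x)
    (fun b x => M.localPoly v (M.bdry b).1 x)

/-- The normal flux `χ K ∇p · n` of a polynomial of degree at most one, at the point `x`. -/
def flux (χ : E d → ℝ) (K : E d → Matrix (Fin d) (Fin d) ℝ) (p : E d →ᵃ[ℝ] ℝ) (n x : E d) : ℝ :=
  χ x * ⟪Matrix.toEuclideanLin (K x) (grad p), n⟫

/-- The average `{χ K ∇v_h · n_e}` on a face (on a boundary face, the only one-sided value). -/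
def avgFlux (M : Mesh D) (χ : E d → ℝ) (K : E d → Matrix (Fin d) (Fin d) ℝ) (v : M.Vh)
    (e : M.Face) (x : E d) : ℝ :=
  Sum.elim
    (fun a => (1 / 2) * (flux χ K (M.localPoly v (M.plus a).1) (M.faceNormal e) x
      + flux χ K (M.localPoly v (M.minus a).1) (M.faceNormal e) x))
    (fun b => flux χ K (M.localPoly v (M.bdry b).1) (M.faceNormal e) x) e

/-- The integral over a face with respect to the `(d - 1)`-dimensional surface measure (counting
measure if `d = 1`). -/
def faceIntegral (M : Mesh D) (e : M.Face) (f : E d → ℝ) : ℝ :=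
  ∫ x in M.faceSet e, f x ∂(Measure.euclideanHausdorffMeasure (d - 1))

/-- The symmetric interior penalty bilinear form `a_{h,ℓ}` with weight `χ = χ_ℓ`. -/
def splitForm (M : Mesh D) (χ : E d → ℝ) (K : E d → Matrix (Fin d) (Fin d) ℝ) (σ : ℝ)
    (v w : M.Vh) : ℝ :=
  (∑ i, ∫ x in (M.elem i).carrier,
      χ x * ⟪Matrix.toEuclideanLin (K x) (grad (M.localPoly v i)), grad (M.localPoly w i)⟫)
    - (∑ e, M.faceIntegral e fun x => M.avgFlux χ K v e x * M.jump w e x)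
    - (∑ e, M.faceIntegral e fun x => M.avgFlux χ K w e x * M.jump v e x)
    + ∑ e, M.faceIntegral e fun x => χ x * (σ / M.faceDiam e) * M.jump v e x * M.jump w e x

/-- `A : V_h → V_h` is the split discrete operator `A_{h,ℓ}`:
`(A v_h, w_h)_{L²(D)} = a_{h,ℓ}(v_h, w_h)` for all `v_h, w_h ∈ V_h`. -/
def IsSplitOperator (M : Mesh D) (χ : E d → ℝ) (K : E d → Matrix (Fin d) (Fin d) ℝ) (σ : ℝ)
    (A : M.Vh →ₗ[ℝ] M.Vh) : Prop :=
  ∀ v w : M.Vh, ⟪A v, w⟫ = M.splitForm χ K σ v w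

/-- `C` is an admissible constant in the discrete trace inequality in `L¹` for polynomials of
degree at most one: `‖p‖_{L¹(e)} ≤ C h_T⁻¹ ‖p‖_{L¹(T)}` for all elements `T` and all faces `e`
of `T`. -/
def IsTraceConstant (M : Mesh D) (C : ℝ) : Prop :=
  0 < C ∧ ∀ (i : Fin M.numElem) (j : Fin (M.elem i).numFaces) (p : E d →ᵃ[ℝ] ℝ),
    ∫ x in (M.elem i).face j, |p x| ∂(Measure.euclideanHausdorffMeasure (d - 1))
      ≤ C * (M.elem i).diam⁻¹ * ∫ x in (M.elem i).carrier, |p x|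

/-- The pair `χ₁, χ₂` of weight functions: Lipschitz continuous (that is, in `W^{1,∞}` of the convex
domain `D`), non-negative, a partition of unity on `D` (so that `0 ≤ χ_ℓ ≤ 1`), and affine on every
element of the mesh. -/
def IsWeightPair (M : Mesh D) (χ : Fin 2 → E d → ℝ) : Prop :=
  (∀ l, ∃ L, LipschitzOnWith L (χ l) (closure D)) ∧
  (∀ l, ∀ x ∈ D, 0 ≤ χ l x) ∧
  (∀ x ∈ D, χ 0 x + χ 1 x = 1) ∧
  ∀ l i, ∃ q : E d →ᵃ[ℝ] ℝ, EqOn (χ l) q (M.elem i).carrier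

end Mesh

/-- A family of meshes is shape regular: every element contains a ball whose radius is
comparable to the diameter of the element, uniformly over all elements and all meshes. -/
def ShapeRegular {d : ℕ} {D : Set (E d)} {I : Type*} (M : I → Mesh D) : Prop :=
  ∃ ρ : ℝ, 0 < ρ ∧ ∀ (h : I) (i : Fin (M h).numElem), ∃ x : E d,
    Metric.closedBall x (ρ * ((M h).elem i).diam) ⊆ ((M h).elem i).carrier

/-- The diffusion coefficient: `K` is Lipschitz continuous on `D` (and denotes its continuous
extension on the closure), symmetric, and for almost every `x ∈ D` the eigenvalues of `K x`
lie in `[K₀, K₁]`, where `K₀, K₁ > 0`. -/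
def IsDiffusion {d : ℕ} (D : Set (E d)) (K : E d → Matrix (Fin d) (Fin d) ℝ) (K₀ K₁ : ℝ) : Prop :=
  0 < K₀ ∧ 0 < K₁ ∧
  (∀ r s, ∃ L, LipschitzOnWith L (fun x => K x r s) (closure D)) ∧
  (∀ x ∈ D, (K x).IsSymm) ∧
  ∀ᵐ x ∂(volume.restrict D), ∀ μ : ℝ,
    Module.End.HasEigenvalue (Matrix.toLin' (K x)) μ → μ ∈ Icc K₀ K₁

end SplitDG

end

/-!
The proof rests on two facts.

*Trace inequality.* Let an element `T` contain a ball of radius `r` around `x₀`, and let `e` be one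
of its facets. By convexity `T` contains the pyramid with apex `x₀` over `e`, whose height `H` is
at least `r`. Cavalieri's principle along the normal of `e` writes the integral over the pyramid as
`H ∫_e ∫₀¹ t ^ (d - 1) |p (x₀ + t (y - x₀))| dt dy` (`SplitDG.lintegral_cone_le`). Along each ray
the function `p` is affine in `t`, and the value at `1` of an affine function of one variable is
controlled by its weighted `L¹` norm on `[0, 1]`
(`SplitDG.abs_add_le_integral_pow_mul_abs`). The resulting constant depends on `d` only and is
divided by `r = ρ h_T`, so shape regularity makes it uniform
(`SplitDG.ShapeRegular.exists_isTraceConstant`).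

*Coercivity.* The weight `χ` is itself a non-negative affine function on each element, so the trace
inequality gives `∫_e χ ≤ C h_T⁻¹ ∫_T χ`, while `∇v` is constant on `T`. On a face, completing the
square bounds the consistency terms plus the penalty from below by `-χ K₁² |∇v|² h_e / σ` on
each side, and the size of `σ` turns the integral of this into at most the fraction `1 / n₀` of
`K₀ |∇v|² ∫_T χ` (`SplitDG.Mesh.flux_cost_le_facetShare`). An element has at most `n₀` facets, so
the element energy pays for all of them (`SplitDG.Mesh.splitForm_self_nonneg`). The spectral bounds
on `K`, given almost everywhere, are used on faces; they hold there by continuity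
(`SplitDG.IsDiffusion.bounds`).

Existence and uniqueness of the operator are the Riesz representation on the finite-dimensional
space `V_h`, for which all integrands have to be integrable: they are continuous on compact sets,
and facets have finite surface measure (`SplitDG.ConvexPolytope.measure_face_lt_top`).
-/

namespace SplitDG

/-! ### The trace inequality on a cone -/

/-- The value at `1` of an affine function on `[0, 1]` is bounded by its `L¹` norm with respect to
the weight `t ^ m`, which is the density of a cone over an `m`-dimensional base. -/
theorem abs_add_le_integral_pow_mul_abs (m : ℕ) (a b : ℝ) :
    |a + b| ≤ (m + 2) * (m + 3) * ∫ t in (0 : ℝ)..1, t ^ m * |a + t * b| := by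
  -- this linear factor is the one for which integration against it, with the weight `t ^ m`,
  -- reproduces the value at `1` of every affine function
  have key : ∫ t in (0 : ℝ)..1, t ^ m * ((m + 2) * ((m + 3) * t - (m + 1))) * (a + t * b)
      = a + b := by
    have h : ∀ t : ℝ, t ^ m * ((m + 2) * ((m + 3) * t - (m + 1))) * (a + t * b)
        = (-(m + 2) * (m + 1) * a) * t ^ m + ((m + 2) * (m + 3) * a - (m + 2) * (m + 1) * b)
            * t ^ (m + 1) + ((m + 2) * (m + 3) * b) * t ^ (m + 2) := by
      intro t; ring
    simp_rw [h]
    rw [intervalIntegral.integral_add, intervalIntegral.integral_add]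
    · simp only [intervalIntegral.integral_const_mul, integral_pow]
      push_cast
      have h1 : (m : ℝ) + 1 ≠ 0 := by positivity
      have h2 : (m : ℝ) + 1 + 1 ≠ 0 := by positivity
      have h3 : (m : ℝ) + 2 + 1 ≠ 0 := by positivity
      simp only [one_pow, ne_eq, Nat.add_eq_zero_iff, one_ne_zero, OfNat.ofNat_ne_zero, and_false,
        not_false_eq_true, zero_pow, sub_zero]
      field_simp
      ring
    all_goals exact Continuous.intervalIntegrable (by fun_prop) _ _
  calc |a + b| = ‖∫ t in (0 : ℝ)..1,
        t ^ m * ((m + 2) * ((m + 3) * t - (m + 1))) * (a + t * b)‖ := by rw [key, Real.norm_eq_abs]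
    _ ≤ ∫ t in (0 : ℝ)..1, ‖t ^ m * ((m + 2) * ((m + 3) * t - (m + 1))) * (a + t * b)‖ :=
        intervalIntegral.norm_integral_le_integral_norm zero_le_one
    _ ≤ ∫ t in (0 : ℝ)..1, (m + 2) * (m + 3) * (t ^ m * |a + t * b|) := by
        refine intervalIntegral.integral_mono_on zero_le_one
          (Continuous.intervalIntegrable (by fun_prop) _ _)
          (Continuous.intervalIntegrable (by fun_prop) _ _) fun t ht => ?_
        have hm : (0 : ℝ) ≤ m := m.cast_nonneg
        have h1 : |((m : ℝ) + 3) * t - (m + 1)| ≤ m + 3 := by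
          rw [abs_le]
          constructor <;> nlinarith [ht.1, ht.2]
        rw [Real.norm_eq_abs, abs_mul, abs_mul, abs_mul, abs_of_nonneg (pow_nonneg ht.1 m),
          abs_of_nonneg (by positivity : (0 : ℝ) ≤ m + 2)]
        have h2 : 0 ≤ t ^ m * |a + t * b| * (m + 2) :=
          mul_nonneg (mul_nonneg (pow_nonneg ht.1 m) (abs_nonneg _)) (by positivity)
        nlinarith [mul_le_mul_of_nonneg_left h1 h2]
    _ = _ := intervalIntegral.integral_const_mul _ _

theorem ofReal_abs_add_le_lintegral (m : ℕ) (a b : ℝ) :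
    ENNReal.ofReal |a + b| ≤ ENNReal.ofReal ((m + 2) * (m + 3)) *
      ∫⁻ t in Ioc (0 : ℝ) 1, ENNReal.ofReal (t ^ m) * ENNReal.ofReal |a + t * b| := by
  refine (ENNReal.ofReal_le_ofReal (abs_add_le_integral_pow_mul_abs m a b)).trans_eq ?_
  rw [ENNReal.ofReal_mul (by positivity), intervalIntegral.integral_of_le zero_le_one,
    ofReal_integral_eq_lintegral_ofReal]
  · congr 1
    refine setLIntegral_congr_fun measurableSet_Ioc fun t ht => ?_
    exact ENNReal.ofReal_mul (pow_nonneg ht.1.le m)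
  · exact (Continuous.integrableOn_Icc (by fun_prop)).mono_set Ioc_subset_Icc_self
  · filter_upwards [ae_restrict_mem measurableSet_Ioc] with t ht
    exact mul_nonneg (pow_nonneg ht.1.le m) (abs_nonneg _)

section Slices

variable {V : Type*} [NormedAddCommGroup V] [InnerProductSpace ℝ V] [FiniteDimensional ℝ V]
  [MeasurableSpace V] [BorelSpace V]

/-- Cavalieri's principle along a unit vector `n`: Lebesgue measure is the product of the length
in the direction of `n` and of the Lebesgue measure of the hyperplane `nᗮ`. -/
theorem measurePreserving_smul_add {n : V} (hn : ‖n‖ = 1) (p : V) :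
    MeasurePreserving (fun z : ℝ × (ℝ ∙ n)ᗮ => (z.1 • n + (z.2 : V)) + p) := by
  have h1 : MeasurePreserving (LinearIsometryEquiv.toSpanUnitSingleton (𝕜 := ℝ) n hn) :=
    LinearIsometryEquiv.measurePreserving _
  have h2 := h1.prod (MeasurePreserving.id (volume : Measure (ℝ ∙ n)ᗮ))
  have h3 := ((ℝ ∙ n).measurePreserving_measurableEquivProd p).symm
  have h4 : (Measure.euclideanHausdorffMeasure (Module.finrank ℝ V) : Measure V) = volume :=
    InnerProductSpace.euclideanHausdorffMeasure_eq_volume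
  rw [h4] at h3
  have h5 := h3.comp h2
  refine (Measure.volume_eq_prod ℝ (ℝ ∙ n)ᗮ) ▸ ?_
  convert h5 using 1
  ext z
  simp

theorem lintegral_eq_lintegral_slices {n : V} (hn : ‖n‖ = 1) (p : V) {f : V → ENNReal}
    (hf : Measurable f) :
    ∫⁻ x, f x = ∫⁻ s : ℝ, ∫⁻ y : (ℝ ∙ n)ᗮ, f ((s • n + (y : V)) + p) := by
  rw [← (measurePreserving_smul_add hn p).lintegral_comp hf, Measure.volume_eq_prod]
  exact lintegral_prod _ (hf.comp (measurePreserving_smul_add hn p).measurable).aemeasurable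

theorem lintegral_comp_smul_mul (f : V → ENNReal) (hf : Measurable f) {t : ℝ} (ht : 0 < t) :
    ∫⁻ y, f y = ENNReal.ofReal (t ^ Module.finrank ℝ V) * ∫⁻ y, f (t • y) := by
  have h := Measure.map_addHaar_smul (volume : Measure V) ht.ne'
  have h2 : ∫⁻ y, f (t • y) = ∫⁻ y, f y ∂(Measure.map (t • ·) volume) :=
    (lintegral_map hf (by fun_prop)).symm
  rw [h2, h, lintegral_smul_measure, smul_eq_mul, ← mul_assoc, ← ENNReal.ofReal_mul (by positivity),
    abs_of_pos (by positivity), mul_inv_cancel₀ (by positivity), ENNReal.ofReal_one, one_mul]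

omit [MeasurableSpace V] [BorelSpace V] in
theorem finrank_orthogonal_span_singleton {n : V} (hn : ‖n‖ = 1) :
    Module.finrank ℝ (ℝ ∙ n)ᗮ = Module.finrank ℝ V - 1 := by
  have h := (ℝ ∙ n).finrank_add_finrank_orthogonal
  rw [finrank_span_singleton (by rintro rfl; simp at hn)] at h
  omega

/-- The surface measure of a hyperplane is the image of the Lebesgue measure of its direction. -/
theorem setLIntegral_hyperplane {n : V} (hn : ‖n‖ = 1) (p : V) {e : Set V} (he : MeasurableSet e)
    (hep : ∀ x ∈ e, ⟪n, x⟫ = ⟪n, p⟫) {f : V → ENNReal} (hf : Measurable f) :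
    ∫⁻ x in e, f x ∂(Measure.euclideanHausdorffMeasure (Module.finrank ℝ V - 1)) =
      ∫⁻ y : (ℝ ∙ n)ᗮ, e.indicator f ((y : V) + p) := by
  have hiso : Isometry (fun y : (ℝ ∙ n)ᗮ => (y : V) + p) :=
    (IsometryEquiv.addRight p).isometry.comp isometry_subtype_coe
  have h := hiso.map_euclideanHausdorffMeasure (d := Module.finrank ℝ (ℝ ∙ n)ᗮ)
  rw [InnerProductSpace.euclideanHausdorffMeasure_eq_volume] at h
  rw [finrank_orthogonal_span_singleton hn] at h
  have hsub : e ⊆ range (fun y : (ℝ ∙ n)ᗮ => (y : V) + p) := by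
    intro x hx
    refine ⟨⟨x - p, ?_⟩, by simp⟩
    rw [Submodule.mem_orthogonal_singleton_iff_inner_right, inner_sub_right, hep x hx, sub_self]
  rw [← lintegral_map (hf.indicator he) hiso.continuous.measurable, h, lintegral_indicator he,
    Measure.restrict_restrict he, inter_eq_left.2 hsub]

/-- The `L¹` trace inequality on the base `e` of the cone with apex `p` and height `H`, for any
convex set `T` that contains the apex and the base. Only the slices of `T` at heights `t * H` with
`0 < t ≤ 1` are used, and each of them contains the base scaled by `t`. -/
theorem lintegral_cone_le {n : V} (hn : ‖n‖ = 1) (p : V) {H : ℝ} (hH : 0 < H) {T e : Set V}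
    (hT : Convex ℝ T) (hTm : MeasurableSet T) (hem : MeasurableSet e) (hp : p ∈ T) (heT : e ⊆ T)
    (q : V →ᵃ[ℝ] ℝ) (he : ∀ x ∈ e, ⟪n, x⟫ = ⟪n, p⟫ + H) :
    ENNReal.ofReal H * ∫⁻ x in e, ENNReal.ofReal |q x|
        ∂(Measure.euclideanHausdorffMeasure (Module.finrank ℝ V - 1))
      ≤ ENNReal.ofReal ((((Module.finrank ℝ V - 1 : ℕ) : ℝ) + 2) *
          (((Module.finrank ℝ V - 1 : ℕ) : ℝ) + 3)) *
        ∫⁻ x in T, ENNReal.ofReal |q x| := by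
  set m := Module.finrank ℝ V - 1 with hm
  have hqc : Continuous q := q.continuous_of_finiteDimensional
  set f : V → ENNReal := fun x => ENNReal.ofReal |q x| with hf
  have hfm : Measurable f := (ENNReal.continuous_ofReal.comp hqc.abs).measurable
  have hmF : Module.finrank ℝ (ℝ ∙ n)ᗮ = m := finrank_orthogonal_span_singleton hn
  -- the indicator function of the base, moved to the hyperplane `nᗮ`
  set g : (ℝ ∙ n)ᗮ → ENNReal := fun y => e.indicator 1 ((y : V) + (p + H • n)) with hg
  have hgm : Measurable g := (measurable_one.indicator hem).comp (by fun_prop)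
  have hpt : ∀ t ∈ Ioc (0 : ℝ) 1, ∀ y : (ℝ ∙ n)ᗮ,
      g y * f (((t * H) • n + ((t • y : (ℝ ∙ n)ᗮ) : V)) + p)
        ≤ T.indicator f (((t * H) • n + ((t • y : (ℝ ∙ n)ᗮ) : V)) + p) := by
    intro t ht y
    by_cases hy : (y : V) + (p + H • n) ∈ e
    · have hmem : ((t * H) • n + ((t • y : (ℝ ∙ n)ᗮ) : V)) + p ∈ T := by
        have h := hT hp (heT hy) (sub_nonneg.2 ht.2) ht.1.le (sub_add_cancel 1 t)
        convert h using 1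
        simp only [Submodule.coe_smul]
        module
      rw [indicator_of_mem hmem]
      simp [hg, hy]
    · simp [hg, hy]
  have hval : ∀ y : (ℝ ∙ n)ᗮ, e.indicator f ((y : V) + (p + H • n)) ≤
      ENNReal.ofReal (((m : ℝ) + 2) * (m + 3)) * ∫⁻ t in Ioc (0 : ℝ) 1, ENNReal.ofReal (t ^ m) *
        (g y * f (((t * H) • n + ((t • y : (ℝ ∙ n)ᗮ) : V)) + p)) := by
    intro y
    by_cases hy : (y : V) + (p + H • n) ∈ e
    · have h1 : g y = 1 := by simp [hg, hy]
      have h2 : ∀ t : ℝ, q (((t * H) • n + ((t • y : (ℝ ∙ n)ᗮ) : V)) + p)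
          = q p + t * q.linear ((y : V) + H • n) := by
        intro t
        have : ((t * H) • n + ((t • y : (ℝ ∙ n)ᗮ) : V)) + p = (t • ((y : V) + H • n)) +ᵥ p := by
          simp only [Submodule.coe_smul, vadd_eq_add]
          module
        rw [this, q.map_vadd, map_smul, vadd_eq_add, smul_eq_mul, add_comm]
      have h3 : q ((y : V) + (p + H • n)) = q p + q.linear ((y : V) + H • n) := by
        have : (y : V) + (p + H • n) = ((y : V) + H • n) +ᵥ p := by
          rw [vadd_eq_add]; abel
        rw [this, q.map_vadd, vadd_eq_add, add_comm]
      simp only [h1, one_mul, hf, h2, indicator_of_mem hy, h3]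
      exact ofReal_abs_add_le_lintegral m _ _
    · simp [hy]
  have hslice : ∀ t ∈ Ioc (0 : ℝ) 1, ENNReal.ofReal (t ^ m) *
      ∫⁻ y : (ℝ ∙ n)ᗮ, g y * f (((t * H) • n + ((t • y : (ℝ ∙ n)ᗮ) : V)) + p) ≤
      ∫⁻ y : (ℝ ∙ n)ᗮ, T.indicator f (((t * H) • n + (y : V)) + p) := by
    intro t ht
    rw [lintegral_comp_smul_mul (fun y : (ℝ ∙ n)ᗮ => T.indicator f (((t * H) • n + (y : V)) + p))
      ((hfm.indicator hTm).comp (by fun_prop)) ht.1, hmF]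
    gcongr with y
    exact hpt t ht y
  have hjm : Measurable fun z : (ℝ ∙ n)ᗮ × ℝ => ENNReal.ofReal (z.2 ^ m) *
      (g z.1 * f (((z.2 * H) • n + ((z.2 • z.1 : (ℝ ∙ n)ᗮ) : V)) + p)) := by
    have h1 : Continuous fun z : (ℝ ∙ n)ᗮ × ℝ =>
      f (((z.2 * H) • n + ((z.2 • z.1 : (ℝ ∙ n)ᗮ) : V)) + p) := by
      exact ENNReal.continuous_ofReal.comp (hqc.abs.comp (by fun_prop))
    have h2 := h1.measurable
    fun_prop
  -- the vertical coordinate is rescaled to `t = s / H`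
  have hscale : ENNReal.ofReal H * ∫⁻ t in Ioc (0 : ℝ) 1,
      ∫⁻ y : (ℝ ∙ n)ᗮ, T.indicator f (((t * H) • n + (y : V)) + p) ≤ ∫⁻ x in T, f x := by
    have hsm : Measurable fun s : ℝ =>
        ∫⁻ y : (ℝ ∙ n)ᗮ, T.indicator f ((s • n + (y : V)) + p) := by
      refine Measurable.lintegral_prod_right' (f := fun z : ℝ × (ℝ ∙ n)ᗮ =>
        T.indicator f ((z.1 • n + (z.2 : V)) + p)) ?_
      exact (hfm.indicator hTm).comp (measurePreserving_smul_add hn p).measurable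
    rw [← lintegral_indicator hTm, lintegral_eq_lintegral_slices hn p (hfm.indicator hTm),
      lintegral_comp_smul_mul _ hsm hH, Module.finrank_self, pow_one]
    refine mul_le_mul_right ?_ _
    refine (setLIntegral_le_lintegral _ _).trans_eq ?_
    simp [mul_comm]
  have hface := setLIntegral_hyperplane hn (p + H • n) hem (fun x hx => by
    rw [he x hx, inner_add_right, inner_smul_right, real_inner_self_eq_norm_sq, hn]; ring) hfm
  rw [hface]
  calc ENNReal.ofReal H * ∫⁻ y : (ℝ ∙ n)ᗮ, e.indicator f ((y : V) + (p + H • n))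
      ≤ ENNReal.ofReal H * ∫⁻ y : (ℝ ∙ n)ᗮ, ENNReal.ofReal (((m : ℝ) + 2) * (m + 3)) *
          ∫⁻ t in Ioc (0 : ℝ) 1, ENNReal.ofReal (t ^ m) *
            (g y * f (((t * H) • n + ((t • y : (ℝ ∙ n)ᗮ) : V)) + p)) := by
        gcongr with y
        exact hval y
    _ = ENNReal.ofReal H * (ENNReal.ofReal (((m : ℝ) + 2) * (m + 3)) *
          ∫⁻ t in Ioc (0 : ℝ) 1, ENNReal.ofReal (t ^ m) *
            ∫⁻ y : (ℝ ∙ n)ᗮ, g y * f (((t * H) • n + ((t • y : (ℝ ∙ n)ᗮ) : V)) + p)) := by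
        rw [lintegral_const_mul _ (Measurable.lintegral_prod_right' hjm),
          lintegral_lintegral_swap hjm.aemeasurable]
        congr 3
        ext t
        have h1 : Measurable fun y : (ℝ ∙ n)ᗮ => ((t * H) • n + ((t • y : (ℝ ∙ n)ᗮ) : V)) + p := by
          fun_prop
        have h2 : Measurable fun y : (ℝ ∙ n)ᗮ =>
          g y * f (((t * H) • n + ((t • y : (ℝ ∙ n)ᗮ) : V)) + p) := hgm.mul (hfm.comp h1)
        exact lintegral_const_mul (ENNReal.ofReal (t ^ m)) h2
    _ ≤ ENNReal.ofReal H * (ENNReal.ofReal (((m : ℝ) + 2) * (m + 3)) *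
          ∫⁻ t in Ioc (0 : ℝ) 1,
            ∫⁻ y : (ℝ ∙ n)ᗮ, T.indicator f (((t * H) • n + (y : V)) + p)) := by
        gcongr ENNReal.ofReal H * (ENNReal.ofReal (((m : ℝ) + 2) * (m + 3)) * ?_)
        exact setLIntegral_mono' measurableSet_Ioc hslice
    _ = ENNReal.ofReal (((m : ℝ) + 2) * (m + 3)) * (ENNReal.ofReal H *
          ∫⁻ t in Ioc (0 : ℝ) 1,
            ∫⁻ y : (ℝ ∙ n)ᗮ, T.indicator f (((t * H) • n + (y : V)) + p)) := by ring
    _ ≤ _ := by gcongr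

end Slices

/-! ### Polytopes and the uniform trace constant -/

namespace ConvexPolytope

variable {d : ℕ} (T : ConvexPolytope d)

theorem isClosed_carrier : IsClosed T.carrier := by
  simp only [carrier, Set.ofPred_forall]
  exact isClosed_iInter fun j => isClosed_le (by fun_prop) continuous_const

theorem isCompact_carrier : IsCompact T.carrier :=
  Metric.isCompact_of_isClosed_isBounded T.isClosed_carrier T.isBounded

theorem convex_carrier : Convex ℝ T.carrier := by
  simp only [carrier, Set.ofPred_forall]
  exact convex_iInter fun j => convex_halfSpace_le (innerSL ℝ (T.normal j)).toLinearMap.isLinear _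

theorem face_subset (j : Fin T.numFaces) : T.face j ⊆ T.carrier := fun _ hx => hx.1

theorem isCompact_face (j : Fin T.numFaces) : IsCompact (T.face j) :=
  T.isCompact_carrier.inter_right (isClosed_eq (by fun_prop) continuous_const)

theorem measurableSet_face (j : Fin T.numFaces) : MeasurableSet (T.face j) :=
  (T.isCompact_face j).isClosed.measurableSet

theorem nonempty_interior_carrier : (interior T.carrier).Nonempty := T.interior_nonempty

/-- A facet is the isometric image of a bounded subset of the hyperplane orthogonal to its
normal. -/
theorem measure_face_lt_top (j : Fin T.numFaces) :
    Measure.euclideanHausdorffMeasure (d - 1) (T.face j) < ⊤ := by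
  have hn := T.norm_normal j
  have hiso : Isometry (fun y : (ℝ ∙ T.normal j)ᗮ => (y : E d) + T.offset j • T.normal j) :=
    (IsometryEquiv.addRight _).isometry.comp isometry_subtype_coe
  have h := setLIntegral_hyperplane hn (T.offset j • T.normal j) (T.measurableSet_face j)
    (fun x hx => by
      rw [hx.2, inner_smul_right, real_inner_self_eq_norm_sq, hn]; ring)
    (f := 1) measurable_one
  rw [finrank_euclideanSpace_fin] at h
  simp only [Pi.one_apply, lintegral_const, one_mul, Measure.restrict_apply_univ] at h
  have h2 : (fun y : (ℝ ∙ T.normal j)ᗮ => (T.face j).indicator (1 : E d → ENNReal)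
      ((y : E d) + T.offset j • T.normal j)) =
      ((fun y : (ℝ ∙ T.normal j)ᗮ => (y : E d) + T.offset j • T.normal j) ⁻¹'
        T.face j).indicator 1 := rfl
  rw [h, h2, lintegral_indicator_one]
  · refine Bornology.IsBounded.measure_lt_top ?_
    exact hiso.antilipschitz.isBounded_preimage (T.isCompact_face j).isBounded
  · exact hiso.continuous.measurable (T.measurableSet_face j)

theorem diam_pos [NeZero d] : 0 < T.diam := by
  obtain ⟨x, hx⟩ := T.nonempty_interior_carrier
  have : Nontrivial (E d) := inferInstance
  have h1 : (T.carrier).Nontrivial :=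
    (infinite_of_mem_nhds x (mem_interior_iff_mem_nhds.1 hx)).nontrivial
  exact Metric.diam_pos h1 T.isCompact_carrier.isBounded

theorem integrableOn_face {f : E d → ℝ} {j : Fin T.numFaces} (hf : ContinuousOn f (T.face j)) :
    IntegrableOn f (T.face j) (Measure.euclideanHausdorffMeasure (d - 1)) := by
  have : IsFiniteMeasure ((Measure.euclideanHausdorffMeasure (d - 1)).restrict (T.face j)) :=
    ⟨by simpa using T.measure_face_lt_top j⟩
  obtain ⟨C, hC⟩ := (T.isCompact_face j).exists_bound_of_continuousOn hf
  exact Integrable.of_bound (hf.aestronglyMeasurable (T.measurableSet_face j)) C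
    ((ae_restrict_mem (T.measurableSet_face j)).mono hC)

theorem integrableOn_carrier {f : E d → ℝ} (hf : ContinuousOn f T.carrier) :
    IntegrableOn f T.carrier :=
  hf.integrableOn_compact T.isCompact_carrier

/-- The trace inequality in `L¹` for an element that contains a ball around `x₀`: the pyramid with
apex `x₀` over a facet is contained in the element, and its height is at least the radius. -/
theorem integral_face_abs_le {x₀ : E d} {r : ℝ} (hr : 0 < r)
    (hball : Metric.closedBall x₀ r ⊆ T.carrier) (j : Fin T.numFaces) (p : E d →ᵃ[ℝ] ℝ) :
    ∫ x in T.face j, |p x| ∂(Measure.euclideanHausdorffMeasure (d - 1)) ≤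
      (((d - 1 : ℕ) : ℝ) + 2) * (((d - 1 : ℕ) : ℝ) + 3) * r⁻¹ * ∫ x in T.carrier, |p x| := by
  have hpc : Continuous fun x => |p x| := p.continuous_of_finiteDimensional.abs
  have hn := T.norm_normal j
  set H := T.offset j - ⟪T.normal j, x₀⟫ with hH
  have hrH : r ≤ H := by
    have h1 : x₀ + r • T.normal j ∈ T.carrier := hball (by
      simp [norm_smul, hn, abs_of_pos hr])
    have h2 := h1 j
    rw [inner_add_right, inner_smul_right, real_inner_self_eq_norm_sq, hn] at h2
    simp only [hH]
    linarith
  have hH0 : 0 < H := hr.trans_le hrH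
  have h := lintegral_cone_le hn x₀ hH0 T.convex_carrier T.isClosed_carrier.measurableSet
    (T.measurableSet_face j) (hball (Metric.mem_closedBall_self hr.le)) (T.face_subset j) p
    (fun x hx => by rw [hx.2, hH]; ring)
  rw [finrank_euclideanSpace_fin,
    ← ofReal_integral_eq_lintegral_ofReal (T.integrableOn_face hpc.continuousOn)
      (ae_of_all _ fun _ => abs_nonneg _),
    ← ofReal_integral_eq_lintegral_ofReal (T.integrableOn_carrier hpc.continuousOn)
      (ae_of_all _ fun _ => abs_nonneg _), ← ENNReal.ofReal_mul hH0.le,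
    ← ENNReal.ofReal_mul (by positivity), ENNReal.ofReal_le_ofReal_iff (by positivity)] at h
  have hI : 0 ≤ ∫ x in T.face j, |p x| ∂(Measure.euclideanHausdorffMeasure (d - 1)) :=
    integral_nonneg fun _ => abs_nonneg _
  have h3 := (mul_le_mul_of_nonneg_right hrH hI).trans h
  calc _ = r⁻¹ * (r * ∫ x in T.face j, |p x| ∂(Measure.euclideanHausdorffMeasure (d - 1))) := by
        field_simp
    _ ≤ r⁻¹ * ((((d - 1 : ℕ) : ℝ) + 2) * (((d - 1 : ℕ) : ℝ) + 3) *
          ∫ x in T.carrier, |p x|) := by gcongr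
    _ = _ := by ring

end ConvexPolytope

theorem ShapeRegular.exists_isTraceConstant {d : ℕ} [NeZero d] {D : Set (E d)} {I : Type*}
    {M : I → Mesh D} (hM : ShapeRegular M) : ∃ C : ℝ, ∀ h : I, (M h).IsTraceConstant C := by
  obtain ⟨ρ, hρ, hball⟩ := hM
  refine ⟨(((d - 1 : ℕ) : ℝ) + 2) * (((d - 1 : ℕ) : ℝ) + 3) * ρ⁻¹, fun h => ⟨by positivity, ?_⟩⟩
  intro i j p
  obtain ⟨x₀, hx₀⟩ := hball h i
  have := ((M h).elem i).integral_face_abs_le (mul_pos hρ ((M h).elem i).diam_pos) hx₀ j p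
  rwa [mul_inv, ← mul_assoc] at this

/-! ### The diffusion coefficient and the space of piecewise affine functions -/

section Diffusion

variable {d : ℕ}

theorem inner_toEuclideanLin_comm {A : Matrix (Fin d) (Fin d) ℝ} (hA : A.IsSymm) (u w : E d) :
    ⟪Matrix.toEuclideanLin A u, w⟫ = ⟪u, Matrix.toEuclideanLin A w⟫ := by
  have hH : A.IsHermitian := by
    rw [Matrix.IsHermitian, Matrix.conjTranspose_eq_transpose_of_trivial]; exact hA
  exact Matrix.isSymmetric_toEuclideanLin_iff.2 hH u w

theorem bounds_of_eigenvalues_mem_Icc {A : Matrix (Fin d) (Fin d) ℝ} (hA : A.IsSymm) {K₀ K₁ : ℝ}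
    (hK₀ : 0 ≤ K₀)
    (h : ∀ μ : ℝ, Module.End.HasEigenvalue (Matrix.toLin' A) μ → μ ∈ Icc K₀ K₁) (u : E d) :
    K₀ * ‖u‖ ^ 2 ≤ ⟪Matrix.toEuclideanLin A u, u⟫ ∧
      ‖Matrix.toEuclideanLin A u‖ ^ 2 ≤ K₁ ^ 2 * ‖u‖ ^ 2 := by
  have hH : A.IsHermitian := by
    rw [Matrix.IsHermitian, Matrix.conjTranspose_eq_transpose_of_trivial]; exact hA
  set b := hH.eigenvectorBasis with hb
  set lam := hH.eigenvalues with hlam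
  have heig : ∀ j, Matrix.toEuclideanLin A (b j) = lam j • b j := by
    intro j
    have := hH.mulVec_eigenvectorBasis j
    ext i
    simpa [Matrix.toLpLin_apply] using congrFun this i
  have hmem : ∀ j, lam j ∈ Icc K₀ K₁ := by
    intro j
    refine h _ (Module.End.hasEigenvalue_of_hasEigenvector (x := (b j).ofLp) ?_)
    refine Module.End.hasEigenvector_iff.2 ⟨Module.End.mem_eigenspace_iff.2 ?_, ?_⟩
    · rw [Matrix.toLin'_apply]
      exact hH.mulVec_eigenvectorBasis j
    · intro h0
      have h1 := b.orthonormal.ne_zero j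
      apply h1
      ext i
      exact congrFun h0 i
  have hcoef : ∀ j, ⟪b j, Matrix.toEuclideanLin A u⟫ = lam j * ⟪b j, u⟫ := by
    intro j
    rw [← inner_toEuclideanLin_comm hA, heig, real_inner_smul_left]
  constructor
  · rw [← b.sum_inner_mul_inner, ← b.sum_sq_norm_inner_right u, Finset.mul_sum]
    refine Finset.sum_le_sum fun j _ => ?_
    rw [real_inner_comm (b j) (Matrix.toEuclideanLin A u), hcoef, Real.norm_eq_abs, sq_abs]
    nlinarith [mul_le_mul_of_nonneg_right (hmem j).1 (sq_nonneg ⟪b j, u⟫)]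
  · rw [← b.sum_sq_norm_inner_right, ← b.sum_sq_norm_inner_right u, Finset.mul_sum]
    refine Finset.sum_le_sum fun j _ => ?_
    rw [hcoef, Real.norm_eq_abs, Real.norm_eq_abs, sq_abs, sq_abs, mul_pow]
    have h1 := hmem j
    have h2 : lam j ^ 2 ≤ K₁ ^ 2 := pow_le_pow_left₀ (hK₀.trans h1.1) h1.2 2
    exact mul_le_mul_of_nonneg_right h2 (sq_nonneg _)

variable {D : Set (E d)} {K : E d → Matrix (Fin d) (Fin d) ℝ} {K₀ K₁ : ℝ}

theorem IsDiffusion.continuousOn_inner (hK : IsDiffusion D K K₀ K₁) (u w : E d) :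
    ContinuousOn (fun x => ⟪Matrix.toEuclideanLin (K x) u, w⟫) (closure D) := by
  have hc : ∀ r s, ContinuousOn (fun x => K x r s) (closure D) := fun r s =>
    (hK.2.2.1 r s).choose_spec.continuousOn
  simp only [PiLp.inner_apply, Matrix.toLpLin_apply, Matrix.mulVec, dotProduct,
    RCLike.inner_apply, conj_trivial]
  fun_prop

/-- The spectral bounds on the diffusion coefficient, known almost everywhere, hold at every
point of the closure by continuity; this includes the faces, which are null sets. -/
theorem IsDiffusion.bounds (hD : IsOpen D) (hK : IsDiffusion D K K₀ K₁) {x : E d}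
    (hx : x ∈ closure D) (u : E d) :
    K₀ * ‖u‖ ^ 2 ≤ ⟪Matrix.toEuclideanLin (K x) u, u⟫ ∧
      ∀ n : E d, ‖n‖ = 1 → ⟪Matrix.toEuclideanLin (K x) u, n⟫ ^ 2 ≤ K₁ ^ 2 * ‖u‖ ^ 2 := by
  obtain ⟨hK₀, -, -, hsymm, hae⟩ := id hK
  rw [ae_restrict_iff' hD.measurableSet] at hae
  have hdense := Measure.dense_of_ae hae
  set S := D ∩ {x | x ∈ D → ∀ μ : ℝ,
    Module.End.HasEigenvalue (Matrix.toLin' (K x)) μ → μ ∈ Icc K₀ K₁} with hS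
  have hcl : closure S = closure D :=
    (closure_mono inter_subset_left).antisymm
      (closure_minimal (hdense.open_subset_closure_inter hD) isClosed_closure)
  have hb : ∀ y ∈ S, K₀ * ‖u‖ ^ 2 ≤ ⟪Matrix.toEuclideanLin (K y) u, u⟫ ∧
      ‖Matrix.toEuclideanLin (K y) u‖ ^ 2 ≤ K₁ ^ 2 * ‖u‖ ^ 2 := fun y hy =>
    bounds_of_eigenvalues_mem_Icc (hsymm y hy.1) hK₀.le (hy.2 hy.1) u
  rw [← hcl] at hx
  have hcont := hK.continuousOn_inner
  rw [← hcl] at hcont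
  refine ⟨le_on_closure (fun y hy => (hb y hy).1) continuousOn_const (hcont u u) hx,
    fun n hn => ?_⟩
  refine le_on_closure (fun y hy => le_trans ?_ (hb y hy).2) ((hcont u n).pow 2)
    continuousOn_const hx
  have := abs_real_inner_le_norm (Matrix.toEuclideanLin (K y) u) n
  rw [hn, mul_one] at this
  exact sq_le_sq' (abs_le.1 this).1 (abs_le.1 this).2

end Diffusion

namespace Mesh

variable {d : ℕ} {D : Set (E d)} (M : Mesh D)

theorem carrier_subset_closure (i : Fin M.numElem) : (M.elem i).carrier ⊆ closure D := by
  rw [M.cover]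
  exact subset_iUnion (fun i => (M.elem i).carrier) i

theorem faceSet_eq (e : M.Face) :
    ∃ (i : Fin M.numElem) (j : Fin (M.elem i).numFaces), M.faceSet e = (M.elem i).face j := by
  rcases e with a | b
  · exact ⟨_, _, rfl⟩
  · exact ⟨_, _, rfl⟩

theorem faceSet_subset_closure (e : M.Face) : M.faceSet e ⊆ closure D := by
  obtain ⟨i, j, h⟩ := M.faceSet_eq e
  rw [h]
  exact ((M.elem i).face_subset j).trans (M.carrier_subset_closure i)

theorem measurableSet_faceSet (e : M.Face) : MeasurableSet (M.faceSet e) := by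
  obtain ⟨i, j, h⟩ := M.faceSet_eq e
  rw [h]
  exact (M.elem i).measurableSet_face j

theorem norm_faceNormal (e : M.Face) : ‖M.faceNormal e‖ = 1 := by
  rcases e with a | b
  · exact ConvexPolytope.norm_normal _ _
  · exact ConvexPolytope.norm_normal _ _

theorem integrableOn_faceSet {f : E d → ℝ} (e : M.Face) (hf : ContinuousOn f (closure D)) :
    IntegrableOn f (M.faceSet e) (Measure.euclideanHausdorffMeasure (d - 1)) := by
  have h' := M.faceSet_subset_closure e
  obtain ⟨i, j, h⟩ := M.faceSet_eq e
  rw [h] at h' ⊢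
  exact (M.elem i).integrableOn_face (hf.mono h')

theorem faceDiam_pos [NeZero d] (e : M.Face) : 0 < M.faceDiam e := by
  rcases e with a | b
  · exact lt_min (ConvexPolytope.diam_pos _) (ConvexPolytope.diam_pos _)
  · exact ConvexPolytope.diam_pos _

theorem localPoly_spec (v : M.Vh) (i : Fin M.numElem) :
    ((v : Lp ℝ 2 (volume.restrict D)) : E d → ℝ)
      =ᵐ[volume.restrict (D ∩ (M.elem i).carrier)] M.localPoly v i :=
  (v.2 i).choose_spec

variable {M}

/-- Every element meets the open set `D` in a set with non-empty interior, because its own interior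
lies in the closure of `D`; hence the polynomial on an element is determined almost everywhere. -/
theorem affineMap_eq_of_ae_eq (hD : IsOpen D) {i : Fin M.numElem} {p q : E d →ᵃ[ℝ] ℝ}
    (h : p =ᵐ[volume.restrict (D ∩ (M.elem i).carrier)] q) : p = q := by
  have hU : IsOpen (D ∩ interior (M.elem i).carrier) := hD.inter isOpen_interior
  have hne : (D ∩ interior (M.elem i).carrier).Nonempty := by
    obtain ⟨x, hx⟩ := (M.elem i).nonempty_interior_carrier
    obtain ⟨y, hy⟩ := mem_closure_iff.1
      (M.carrier_subset_closure i (interior_subset hx)) _ isOpen_interior hx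
    exact ⟨y, hy.2, hy.1⟩
  have h1 : p =ᵐ[volume.restrict (D ∩ interior (M.elem i).carrier)] q :=
    ae_mono (Measure.restrict_mono (inter_subset_inter_right _ interior_subset) le_rfl) h
  have h2 := Measure.eqOn_open_of_ae_eq h1 hU p.continuous_of_finiteDimensional.continuousOn
    q.continuous_of_finiteDimensional.continuousOn
  exact AffineMap.ext_on (hU.affineSpan_eq_top hne) h2

theorem localPoly_eq (hD : IsOpen D) {v : M.Vh} {i : Fin M.numElem} {p : E d →ᵃ[ℝ] ℝ}
    (h : ((v : Lp ℝ 2 (volume.restrict D)) : E d → ℝ)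
      =ᵐ[volume.restrict (D ∩ (M.elem i).carrier)] p) : M.localPoly v i = p :=
  affineMap_eq_of_ae_eq hD ((M.localPoly_spec v i).symm.trans h)

/-- The restriction `v ↦ v|_T` as a linear map. -/
noncomputable def localPolyₗ (M : Mesh D) (hD : IsOpen D) (i : Fin M.numElem) : M.Vh →ₗ[ℝ] (E d →ᵃ[ℝ] ℝ) where
  toFun v := M.localPoly v i
  map_add' v w := by
    refine localPoly_eq hD ?_
    filter_upwards [M.localPoly_spec v i, M.localPoly_spec w i,
      ae_mono (Measure.restrict_mono inter_subset_left le_rfl)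
        (Lp.coeFn_add (v : Lp ℝ 2 (volume.restrict D)) w)] with x h1 h2 h3
    rw [Submodule.coe_add, h3, Pi.add_apply, h1, h2, AffineMap.coe_add, Pi.add_apply]
  map_smul' c v := by
    refine localPoly_eq hD ?_
    filter_upwards [M.localPoly_spec v i,
      ae_mono (Measure.restrict_mono inter_subset_left le_rfl)
        (Lp.coeFn_smul c (v : Lp ℝ 2 (volume.restrict D)))] with x h1 h2
    rw [Submodule.coe_smul, h2, Pi.smul_apply, h1, RingHom.id_apply, AffineMap.coe_smul,
      Pi.smul_apply]

theorem finiteDimensional_Vh (hD : IsOpen D) : FiniteDimensional ℝ M.Vh := by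
  let Φ : M.Vh →ₗ[ℝ] (Fin M.numElem → ℝ × (E d →ₗ[ℝ] ℝ)) :=
    LinearMap.pi fun i => (AffineMap.toConstProdLinearMap ℝ).toLinearMap ∘ₗ
      M.localPolyₗ hD i
  refine FiniteDimensional.of_injective Φ ((injective_iff_map_eq_zero _).2 fun v hv => ?_)
  have h0 : ∀ i, M.localPoly v i = 0 := fun i =>
    (AffineMap.toConstProdLinearMap ℝ).map_eq_zero_iff.1 (congrFun hv i)
  refine Subtype.ext ((Lp.eq_zero_iff_ae_eq_zero).2 ?_)
  have hcov : D = ⋃ i, D ∩ (M.elem i).carrier := by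
    rw [← inter_iUnion, ← M.cover, inter_eq_left.2 subset_closure]
  have hall : ∀ᵐ x ∂(volume.restrict (⋃ i, D ∩ (M.elem i).carrier)),
      ((v : Lp ℝ 2 (volume.restrict D)) : E d → ℝ) x = 0 := by
    rw [ae_restrict_iUnion_iff]
    intro i
    filter_upwards [M.localPoly_spec v i] with x hx
    rw [hx, h0 i]
    rfl
  rw [← hcov] at hall
  exact hall

end Mesh

/-! ### The bilinear form and its operator -/

/-- Integrating a family of bilinear forms gives a bilinear form. -/
theorem exists_bilin_eq_integral {X V : Type*} [MeasurableSpace X] {μ : Measure X}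
    [AddCommGroup V] [Module ℝ V] (F : X → V →ₗ[ℝ] V →ₗ[ℝ] ℝ)
    (hF : ∀ v w, Integrable (fun x => F x v w) μ) :
    ∃ B : V →ₗ[ℝ] V →ₗ[ℝ] ℝ, ∀ v w, B v w = ∫ x, F x v w ∂μ := by
  refine ⟨LinearMap.mk₂ ℝ (fun v w => ∫ x, F x v w ∂μ) ?_ ?_ ?_ ?_, fun v w => rfl⟩
  · intro v v' w
    simp only [map_add, LinearMap.add_apply]
    exact integral_add (hF v w) (hF v' w)
  · intro c v w
    simp only [map_smul, LinearMap.smul_apply]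
    exact integral_smul c _
  · intro v w w'
    simp only [map_add]
    exact integral_add (hF v w) (hF v w')
  · intro c v w
    simp only [map_smul]
    exact integral_smul c _

/-- Riesz representation of a bilinear form on a finite-dimensional inner product space. -/
theorem existsUnique_inner_eq {V : Type*} [NormedAddCommGroup V] [InnerProductSpace ℝ V]
    [FiniteDimensional ℝ V] (B : V →ₗ[ℝ] V →ₗ[ℝ] ℝ) :
    ∃! A : V →ₗ[ℝ] V, ∀ v w, ⟪A v, w⟫ = B v w := by
  have : CompleteSpace V := FiniteDimensional.complete ℝ V
  refine ⟨(InnerProductSpace.toDual ℝ V).symm.toLinearEquiv.toLinearMap ∘ₗ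
    LinearMap.toContinuousLinearMap.toLinearMap ∘ₗ B, fun v w => ?_, fun A hA => ?_⟩
  · simp
  · ext1 v
    refine ext_inner_right ℝ fun w => ?_
    rw [hA]
    simp

variable {d : ℕ}

/-- The gradient, as a linear map on the affine functions. -/
noncomputable def gradₗ (d : ℕ) : (E d →ᵃ[ℝ] ℝ) →ₗ[ℝ] E d where
  toFun := grad
  map_add' p q := by simp [grad]
  map_smul' c p := by simp [grad]

/-- Evaluation of affine functions at a point. -/
noncomputable def evalₗ (x : E d) : (E d →ᵃ[ℝ] ℝ) →ₗ[ℝ] ℝ where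
  toFun p := p x
  map_add' _ _ := rfl
  map_smul' _ _ := rfl

/-- The normal flux at a point, as a linear map on the affine functions. -/
noncomputable def fluxₗ (χ : E d → ℝ) (K : E d → Matrix (Fin d) (Fin d) ℝ) (n x : E d) :
    (E d →ᵃ[ℝ] ℝ) →ₗ[ℝ] ℝ :=
  χ x • (innerₗ (E d)).flip n ∘ₗ Matrix.toEuclideanLin (K x) ∘ₗ gradₗ d

namespace Mesh

variable {D : Set (E d)} {M : Mesh D} {χ : E d → ℝ} {K : E d → Matrix (Fin d) (Fin d) ℝ}
  {K₀ K₁ σ : ℝ}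

/-- The jump on a face at a point, as a linear form on `V_h`. -/
noncomputable def jumpₗ (M : Mesh D) (hD : IsOpen D) (e : M.Face) (x : E d) : M.Vh →ₗ[ℝ] ℝ :=
  Sum.elim
    (fun a => evalₗ x ∘ₗ M.localPolyₗ hD (M.plus a).1 - evalₗ x ∘ₗ M.localPolyₗ hD (M.minus a).1)
    (fun b => evalₗ x ∘ₗ M.localPolyₗ hD (M.bdry b).1) e

theorem jumpₗ_apply (hD : IsOpen D) (e : M.Face) (x : E d) (v : M.Vh) :
    M.jumpₗ hD e x v = M.jump v e x := by
  rcases e with a | b <;> rfl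

/-- The averaged flux on a face at a point, as a linear form on `V_h`. -/
noncomputable def avgFluxₗ (M : Mesh D) (hD : IsOpen D) (χ : E d → ℝ)
    (K : E d → Matrix (Fin d) (Fin d) ℝ) (e : M.Face) (x : E d) : M.Vh →ₗ[ℝ] ℝ :=
  Sum.elim
    (fun a => (1 / 2 : ℝ) • (fluxₗ χ K (M.faceNormal e) x ∘ₗ M.localPolyₗ hD (M.plus a).1 +
      fluxₗ χ K (M.faceNormal e) x ∘ₗ M.localPolyₗ hD (M.minus a).1))
    (fun b => fluxₗ χ K (M.faceNormal e) x ∘ₗ M.localPolyₗ hD (M.bdry b).1) e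

theorem avgFluxₗ_apply (hD : IsOpen D) (e : M.Face) (x : E d) (v : M.Vh) :
    M.avgFluxₗ hD χ K e x v = M.avgFlux χ K v e x := by
  rcases e with a | b <;> rfl

theorem continuous_jump (v : M.Vh) (e : M.Face) : Continuous (M.jump v e) := by
  rcases e with a | b
  · exact (M.localPoly v (M.plus a).1).continuous_of_finiteDimensional.sub
      (M.localPoly v (M.minus a).1).continuous_of_finiteDimensional
  · exact (M.localPoly v (M.bdry b).1).continuous_of_finiteDimensional

theorem continuousOn_flux (hχ : ContinuousOn χ (closure D)) (hK : IsDiffusion D K K₀ K₁)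
    (p : E d →ᵃ[ℝ] ℝ) (n : E d) : ContinuousOn (flux χ K p n) (closure D) :=
  hχ.mul (hK.continuousOn_inner _ _)

theorem continuousOn_avgFlux (hχ : ContinuousOn χ (closure D)) (hK : IsDiffusion D K K₀ K₁)
    (v : M.Vh) (e : M.Face) : ContinuousOn (M.avgFlux χ K v e) (closure D) := by
  rcases e with a | b
  · exact continuousOn_const.mul
      ((continuousOn_flux hχ hK _ _).add (continuousOn_flux hχ hK _ _))
  · exact continuousOn_flux hχ hK _ _

theorem integrableOn_diffusion (hχ : ContinuousOn χ (closure D)) (hK : IsDiffusion D K K₀ K₁)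
    (i : Fin M.numElem) (u w : E d) :
    IntegrableOn (fun x => χ x * ⟪Matrix.toEuclideanLin (K x) u, w⟫) (M.elem i).carrier :=
  (M.elem i).integrableOn_carrier
    ((hχ.mul (hK.continuousOn_inner _ _)).mono (M.carrier_subset_closure i))

theorem integrableOn_avgFlux_mul_jump (hχ : ContinuousOn χ (closure D))
    (hK : IsDiffusion D K K₀ K₁) (e : M.Face) (v w : M.Vh) :
    IntegrableOn (fun x => M.avgFlux χ K v e x * M.jump w e x) (M.faceSet e)
      (Measure.euclideanHausdorffMeasure (d - 1)) :=
  M.integrableOn_faceSet e ((continuousOn_avgFlux hχ hK v e).mul (continuous_jump w e).continuousOn)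

theorem integrableOn_penalty (hχ : ContinuousOn χ (closure D)) (σ : ℝ) (e : M.Face) (v w : M.Vh) :
    IntegrableOn (fun x => χ x * (σ / M.faceDiam e) * M.jump v e x * M.jump w e x) (M.faceSet e)
      (Measure.euclideanHausdorffMeasure (d - 1)) :=
  M.integrableOn_faceSet e (((hχ.mul continuousOn_const).mul (continuous_jump v e).continuousOn).mul
    (continuous_jump w e).continuousOn)

/-- Bilinearity of the form: each of its integrands is a bilinear form in `(v, w)` at every point
and is integrable, being continuous on a compact set of finite measure. -/
theorem exists_bilin_eq_splitForm (hD : IsOpen D) (hχ : ContinuousOn χ (closure D))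
    (hK : IsDiffusion D K K₀ K₁) (σ : ℝ) :
    ∃ B : M.Vh →ₗ[ℝ] M.Vh →ₗ[ℝ] ℝ, ∀ v w, B v w = M.splitForm χ K σ v w := by
  have h1 : ∀ i, ∃ B : M.Vh →ₗ[ℝ] M.Vh →ₗ[ℝ] ℝ, ∀ v w, B v w = ∫ x in (M.elem i).carrier,
      χ x * ⟪Matrix.toEuclideanLin (K x) (grad (M.localPoly v i)), grad (M.localPoly w i)⟫ :=
    fun i => exists_bilin_eq_integral (fun x => χ x • (innerₗ (E d)).compl₁₂
      (Matrix.toEuclideanLin (K x) ∘ₗ gradₗ d ∘ₗ M.localPolyₗ hD i) (gradₗ d ∘ₗ M.localPolyₗ hD i))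
      fun v w => integrableOn_diffusion hχ hK i _ _
  have h2 : ∀ e, ∃ B : M.Vh →ₗ[ℝ] M.Vh →ₗ[ℝ] ℝ, ∀ v w, B v w =
      M.faceIntegral e fun x => M.avgFlux χ K v e x * M.jump w e x := by
    intro e
    obtain ⟨B, hB⟩ := exists_bilin_eq_integral
      (μ := (Measure.euclideanHausdorffMeasure (d - 1)).restrict (M.faceSet e))
      (fun x => (M.avgFluxₗ hD χ K e x).smulRight (M.jumpₗ hD e x)) fun v w => by
        simpa [avgFluxₗ_apply, jumpₗ_apply] using
          (integrableOn_avgFlux_mul_jump hχ hK e v w).integrable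
    exact ⟨B, fun v w => by simp [hB, avgFluxₗ_apply, jumpₗ_apply, faceIntegral]⟩
  have h3 : ∀ e, ∃ B : M.Vh →ₗ[ℝ] M.Vh →ₗ[ℝ] ℝ, ∀ v w, B v w =
      M.faceIntegral e fun x => χ x * (σ / M.faceDiam e) * M.jump v e x * M.jump w e x := by
    intro e
    obtain ⟨B, hB⟩ := exists_bilin_eq_integral
      (μ := (Measure.euclideanHausdorffMeasure (d - 1)).restrict (M.faceSet e))
      (fun x => (χ x * (σ / M.faceDiam e)) • (M.jumpₗ hD e x).smulRight (M.jumpₗ hD e x))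
      fun v w => by
        simpa [jumpₗ_apply, mul_assoc] using (integrableOn_penalty hχ σ e v w).integrable
    exact ⟨B, fun v w => by simp [hB, jumpₗ_apply, faceIntegral, mul_assoc]⟩
  choose B₁ hB₁ using h1
  choose B₂ hB₂ using h2
  choose B₃ hB₃ using h3
  refine ⟨∑ i, B₁ i - ∑ e, B₂ e - ∑ e, (B₂ e).flip + ∑ e, B₃ e, fun v w => ?_⟩
  simp only [LinearMap.add_apply, LinearMap.sub_apply, LinearMap.sum_apply, LinearMap.flip_apply,
    hB₁, hB₂, hB₃, splitForm]

theorem existsUnique_isSplitOperator (hD : IsOpen D) (hχ : ContinuousOn χ (closure D))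
    (hK : IsDiffusion D K K₀ K₁) (σ : ℝ) :
    ∃! A : M.Vh →ₗ[ℝ] M.Vh, M.IsSplitOperator χ K σ A := by
  have := finiteDimensional_Vh (M := M) hD
  obtain ⟨B, hB⟩ := exists_bilin_eq_splitForm (M := M) hD hχ hK σ
  simpa only [hB, IsSplitOperator] using existsUnique_inner_eq B

end Mesh

/-! ### Non-negativity -/

namespace Mesh

variable {d : ℕ} {D : Set (E d)} {M : Mesh D}

section Weights

variable {χ : Fin 2 → E d → ℝ}

theorem IsWeightPair.continuousOn (hχ : M.IsWeightPair χ) (l : Fin 2) :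
    ContinuousOn (χ l) (closure D) :=
  (hχ.1 l).choose_spec.continuousOn

theorem IsWeightPair.nonneg (hχ : M.IsWeightPair χ) (l : Fin 2) {x : E d} (hx : x ∈ closure D) :
    0 ≤ χ l x :=
  le_on_closure (hχ.2.1 l) continuousOn_const (hχ.continuousOn l) hx

/-- On an element the weight is a non-negative affine function, so that the trace inequality
applies to the weight itself. -/
theorem IsWeightPair.integral_face_le (hχ : M.IsWeightPair χ) (l : Fin 2) {C : ℝ}
    (hC : M.IsTraceConstant C) (i : Fin M.numElem) (j : Fin (M.elem i).numFaces) :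
    ∫ x in (M.elem i).face j, χ l x ∂(Measure.euclideanHausdorffMeasure (d - 1)) ≤
      C * (M.elem i).diam⁻¹ * ∫ x in (M.elem i).carrier, χ l x := by
  obtain ⟨q, hq⟩ := hχ.2.2.2 l i
  have habs : ∀ x ∈ (M.elem i).carrier, χ l x = |q x| := fun x hx => by
    rw [← hq hx, abs_of_nonneg (hχ.nonneg l (M.carrier_subset_closure i hx))]
  rw [setIntegral_congr_fun ((M.elem i).measurableSet_face j)
      fun x hx => habs x ((M.elem i).face_subset j hx),
    setIntegral_congr_fun (M.elem i).isClosed_carrier.measurableSet habs]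
  exact hC.2 i j q

end Weights

/-- Every facet of every element is listed exactly once, as the `plus` or the `minus` side of an
interior face or as a boundary face. -/
theorem sum_elem_faces (M : Mesh D) (c : (Σ i, Fin (M.elem i).numFaces) → ℝ) :
    ∑ s, c s = ∑ a, (c (M.plus a) + c (M.minus a)) + ∑ b, c (M.bdry b) := by
  rw [← (Equiv.ofBijective _ M.enum_bijective).sum_comp c]
  simp only [Fintype.sum_sum_type, Equiv.ofBijective_apply, Sum.elim_inl, Sum.elim_inr,
    Finset.sum_add_distrib]
  ring

/-- The total contribution of a face to the quadratic form: the two consistency terms and the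
penalty. -/
noncomputable def faceEnergy (M : Mesh D) (χ : E d → ℝ) (K : E d → Matrix (Fin d) (Fin d) ℝ)
    (σ : ℝ) (v : M.Vh) (e : M.Face) : ℝ :=
  M.faceIntegral e fun x => χ x * (σ / M.faceDiam e) * M.jump v e x * M.jump v e x
    - 2 * (M.avgFlux χ K v e x * M.jump v e x)

theorem splitForm_self {χ : E d → ℝ} {K : E d → Matrix (Fin d) (Fin d) ℝ} {K₀ K₁ : ℝ}
    (hχ : ContinuousOn χ (closure D)) (hK : IsDiffusion D K K₀ K₁) (σ : ℝ) (v : M.Vh) :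
    M.splitForm χ K σ v v = (∑ i, ∫ x in (M.elem i).carrier, χ x *
      ⟪Matrix.toEuclideanLin (K x) (grad (M.localPoly v i)), grad (M.localPoly v i)⟫) +
      ∑ e, M.faceEnergy χ K σ v e := by
  have h : ∀ e, M.faceEnergy χ K σ v e =
      (M.faceIntegral e fun x => χ x * (σ / M.faceDiam e) * M.jump v e x * M.jump v e x) -
        2 * M.faceIntegral e fun x => M.avgFlux χ K v e x * M.jump v e x := by
    intro e
    rw [faceEnergy, faceIntegral, faceIntegral, faceIntegral, ← integral_const_mul]
    exact integral_sub (integrableOn_penalty hχ σ e v v)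
      ((integrableOn_avgFlux_mul_jump hχ hK e v v).const_mul 2)
  simp only [h, splitForm, Finset.sum_sub_distrib, ← Finset.mul_sum]
  ring

section Coercivity

variable {χ : Fin 2 → E d → ℝ} {K : E d → Matrix (Fin d) (Fin d) ℝ} {K₀ K₁ σ C : ℝ}

/-- A pointwise lower bound by a multiple of the weight integrates to a lower bound of the face
energy. -/
theorem neg_mul_integral_le_faceEnergy (hK : IsDiffusion D K K₀ K₁) (hχ : M.IsWeightPair χ)
    (l : Fin 2) (v : M.Vh) (e : M.Face) {c : ℝ}
    (h : ∀ x ∈ closure D, -(c * χ l x) ≤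
      χ l x * (σ / M.faceDiam e) * M.jump v e x * M.jump v e x
        - 2 * (M.avgFlux (χ l) K v e x * M.jump v e x)) :
    -(c * M.faceIntegral e (χ l)) ≤ M.faceEnergy (χ l) K σ v e := by
  rw [faceEnergy, faceIntegral, faceIntegral, ← integral_const_mul, ← integral_neg]
  refine setIntegral_mono_on
    (((M.integrableOn_faceSet e (hχ.continuousOn l)).const_mul c).neg)
    ((integrableOn_penalty (hχ.continuousOn l) σ e v v).sub
      ((integrableOn_avgFlux_mul_jump (hχ.continuousOn l) hK e v v).const_mul 2))
    (M.measurableSet_faceSet e) fun x hx => h x (M.faceSet_subset_closure e hx)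

/-- The fraction `1 / n₀` of the lower bound `K₀ |∇v|² ∫_T χ` for the energy of an element `T`:
what is available to absorb one facet of `T`. -/
noncomputable def facetShare (M : Mesh D) (χ : E d → ℝ) (K₀ : ℝ) (v : M.Vh)
    (s : Σ i, Fin (M.elem i).numFaces) : ℝ :=
  K₀ / M.maxFaces * ‖grad (M.localPoly v s.1)‖ ^ 2 * ∫ x in (M.elem s.1).carrier, χ x

theorem numFaces_le_maxFaces (M : Mesh D) (i : Fin M.numElem) :
    (M.elem i).numFaces ≤ M.maxFaces :=
  Finset.le_sup (f := fun i => (M.elem i).numFaces) (Finset.mem_univ i)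

theorem IsWeightPair.integral_carrier_nonneg (hχ : M.IsWeightPair χ) (l : Fin 2)
    (i : Fin M.numElem) : 0 ≤ ∫ x in (M.elem i).carrier, χ l x :=
  setIntegral_nonneg (M.elem i).isClosed_carrier.measurableSet fun _ hx =>
    hχ.nonneg l (M.carrier_subset_closure i hx)

theorem sum_facetShare_le (hD : IsOpen D) (hK : IsDiffusion D K K₀ K₁) (hχ : M.IsWeightPair χ)
    (l : Fin 2) (v : M.Vh) :
    ∑ s, M.facetShare (χ l) K₀ v s ≤ ∑ i, ∫ x in (M.elem i).carrier, χ l x *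
      ⟪Matrix.toEuclideanLin (K x) (grad (M.localPoly v i)), grad (M.localPoly v i)⟫ := by
  rw [Fintype.sum_sigma]
  refine Finset.sum_le_sum fun i _ => ?_
  set g := grad (M.localPoly v i) with hg
  have hI := hχ.integral_carrier_nonneg l i
  have h1 : ((M.elem i).numFaces : ℝ) * (K₀ / M.maxFaces) ≤ K₀ := by
    rw [mul_div_assoc']
    refine div_le_of_le_mul₀ (Nat.cast_nonneg _) hK.1.le ?_
    rw [mul_comm]
    exact mul_le_mul_of_nonneg_left (by exact_mod_cast M.numFaces_le_maxFaces i) hK.1.le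
  calc ∑ j : Fin (M.elem i).numFaces, M.facetShare (χ l) K₀ v ⟨i, j⟩
      = ((M.elem i).numFaces : ℝ) * (K₀ / M.maxFaces) *
          (‖g‖ ^ 2 * ∫ x in (M.elem i).carrier, χ l x) := by
        simp only [facetShare, Finset.sum_const, Finset.card_univ, Fintype.card_fin, nsmul_eq_mul,
          ← hg]
        ring
    _ ≤ K₀ * (‖g‖ ^ 2 * ∫ x in (M.elem i).carrier, χ l x) := by gcongr
    _ = ∫ x in (M.elem i).carrier, K₀ * ‖g‖ ^ 2 * χ l x := by
        rw [integral_const_mul]; ring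
    _ ≤ _ := by
        refine setIntegral_mono_on
          (((M.elem i).integrableOn_carrier
            ((hχ.continuousOn l).mono (M.carrier_subset_closure i))).const_mul _)
          (integrableOn_diffusion (hχ.continuousOn l) hK i g g)
          (M.elem i).isClosed_carrier.measurableSet fun x hx => ?_
        have hx' := M.carrier_subset_closure i hx
        rw [mul_comm]
        exact mul_le_mul_of_nonneg_left (hK.bounds hD hx' g).1 (hχ.nonneg l hx')

/-- The size of the penalty is exactly what makes the flux contribution of one side of a face
fit into the share of the element energy. Positivity of `σ` comes along: the existence of a facet
forces `1 ≤ n₀`. -/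
theorem flux_cost_le_facetShare [NeZero d] (hK : IsDiffusion D K K₀ K₁) (hχ : M.IsWeightPair χ)
    (hC : M.IsTraceConstant C) (hσ : C * K₁ ^ 2 * K₀⁻¹ * M.maxFaces ≤ σ) (l : Fin 2) (v : M.Vh)
    (s : Σ i, Fin (M.elem i).numFaces) {h : ℝ} (h0 : 0 < h) (hh : h ≤ (M.elem s.1).diam) :
    K₁ ^ 2 * ‖grad (M.localPoly v s.1)‖ ^ 2 / (σ / h) *
      ∫ x in (M.elem s.1).face s.2, χ l x ∂(Measure.euclideanHausdorffMeasure (d - 1)) ≤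
      M.facetShare (χ l) K₀ v s ∧ 0 < σ := by
  obtain ⟨i, j⟩ := s
  have hK₀ := hK.1
  have hK₁ := hK.2.1
  have hC0 := hC.1
  have hn : (0 : ℝ) < M.maxFaces := by
    have := M.numFaces_le_maxFaces i
    have := j.pos
    exact_mod_cast (by omega : 0 < M.maxFaces)
  have hσ0 : 0 < σ := lt_of_lt_of_le (by positivity) hσ
  refine ⟨?_, hσ0⟩
  have hI := hχ.integral_carrier_nonneg l i
  have hdiam : 0 < (M.elem i).diam := h0.trans_le hh
  have htr := hχ.integral_face_le l hC i j
  have h1 : C * K₁ ^ 2 / σ ≤ K₀ / M.maxFaces := by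
    rw [div_le_div_iff₀ hσ0 hn]
    calc C * K₁ ^ 2 * M.maxFaces = K₀ * (C * K₁ ^ 2 * K₀⁻¹ * M.maxFaces) := by field_simp
      _ ≤ K₀ * σ := by gcongr
  have h2 : h * (M.elem i).diam⁻¹ ≤ 1 := by
    rw [← div_eq_mul_inv]; exact (div_le_one hdiam).2 hh
  calc K₁ ^ 2 * ‖grad (M.localPoly v i)‖ ^ 2 / (σ / h) *
        ∫ x in (M.elem i).face j, χ l x ∂(Measure.euclideanHausdorffMeasure (d - 1))
      ≤ K₁ ^ 2 * ‖grad (M.localPoly v i)‖ ^ 2 / (σ / h) *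
        (C * (M.elem i).diam⁻¹ * ∫ x in (M.elem i).carrier, χ l x) := by gcongr
    _ = (C * K₁ ^ 2 / σ) * (h * (M.elem i).diam⁻¹) * (‖grad (M.localPoly v i)‖ ^ 2 *
        ∫ x in (M.elem i).carrier, χ l x) := by field_simp
    _ ≤ (K₀ / M.maxFaces) * 1 * (‖grad (M.localPoly v i)‖ ^ 2 *
        ∫ x in (M.elem i).carrier, χ l x) := by gcongr
    _ = M.facetShare (χ l) K₀ v ⟨i, j⟩ := by simp only [facetShare]; ring

theorem facetShare_nonneg (hK : IsDiffusion D K K₀ K₁) (hχ : M.IsWeightPair χ) (l : Fin 2)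
    (v : M.Vh) (s : Σ i, Fin (M.elem i).numFaces) : 0 ≤ M.facetShare (χ l) K₀ v s :=
  mul_nonneg (mul_nonneg (div_nonneg hK.1.le (Nat.cast_nonneg _)) (sq_nonneg _))
    (hχ.integral_carrier_nonneg l s.1)

theorem faceEnergy_bdry_ge [NeZero d] (hD : IsOpen D) (hK : IsDiffusion D K K₀ K₁)
    (hχ : M.IsWeightPair χ) (hC : M.IsTraceConstant C)
    (hσ : C * K₁ ^ 2 * K₀⁻¹ * M.maxFaces ≤ σ) (l : Fin 2) (v : M.Vh) (b : Fin M.numBdry) :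
    -M.facetShare (χ l) K₀ v (M.bdry b) ≤ M.faceEnergy (χ l) K σ v (Sum.inr b) := by
  have h0 := M.faceDiam_pos (Sum.inr b)
  obtain ⟨hcost, hσ0⟩ := flux_cost_le_facetShare hK hχ hC hσ l v (M.bdry b) h0 le_rfl
  refine (neg_le_neg hcost).trans ?_
  have hface : M.faceIntegral (Sum.inr b) (χ l) = ∫ x in (M.elem (M.bdry b).1).face (M.bdry b).2,
    χ l x ∂(Measure.euclideanHausdorffMeasure (d - 1)) := rfl
  rw [← hface]
  refine neg_mul_integral_le_faceEnergy hK hχ l v _ fun x hx => ?_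
  set δ := σ / M.faceDiam (Sum.inr b) with hδ
  have hδ0 : 0 < δ := div_pos hσ0 h0
  set g := grad (M.localPoly v (M.bdry b).1) with hg
  set F := ⟪Matrix.toEuclideanLin (K x) g, M.faceNormal (Sum.inr b)⟫ with hF
  have hFb : F ^ 2 ≤ K₁ ^ 2 * ‖g‖ ^ 2 := (hK.bounds hD hx g).2 _ (M.norm_faceNormal _)
  set s := M.jump v (Sum.inr b) x
  have havg : M.avgFlux (χ l) K v (Sum.inr b) x = χ l x * F := rfl
  rw [havg]
  -- completing the square
  have hsq : 0 ≤ δ * s * s - 2 * (F * s) + F ^ 2 / δ := by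
    have : δ * s * s - 2 * (F * s) + F ^ 2 / δ = δ * (s - F / δ) ^ 2 := by field_simp; ring
    rw [this]; positivity
  have hle : F ^ 2 / δ ≤ K₁ ^ 2 * ‖g‖ ^ 2 / δ := by gcongr
  have := mul_nonneg (hχ.nonneg l hx)
    (by linarith : 0 ≤ δ * s * s - 2 * (F * s) + K₁ ^ 2 * ‖g‖ ^ 2 / δ)
  linarith

theorem faceEnergy_int_ge [NeZero d] (hD : IsOpen D) (hK : IsDiffusion D K K₀ K₁)
    (hχ : M.IsWeightPair χ) (hC : M.IsTraceConstant C)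
    (hσ : C * K₁ ^ 2 * K₀⁻¹ * M.maxFaces ≤ σ) (l : Fin 2) (v : M.Vh) (a : Fin M.numInt) :
    -(M.facetShare (χ l) K₀ v (M.plus a) + M.facetShare (χ l) K₀ v (M.minus a)) ≤
      M.faceEnergy (χ l) K σ v (Sum.inl a) := by
  have h0 := M.faceDiam_pos (Sum.inl a)
  obtain ⟨hcost, hσ0⟩ := flux_cost_le_facetShare hK hχ hC hσ l v (M.plus a) h0 (min_le_left _ _)
  have hcost' := (flux_cost_le_facetShare hK hχ hC hσ l v (M.minus a) h0 (min_le_right _ _)).1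
  rw [← M.plus_face_eq a] at hcost'
  have hp := facetShare_nonneg hK hχ l v (M.plus a)
  have hm := facetShare_nonneg hK hχ l v (M.minus a)
  set δ := σ / M.faceDiam (Sum.inl a) with hδ
  have hδ0 : 0 < δ := div_pos hσ0 h0
  set gp := grad (M.localPoly v (M.plus a).1) with hgp
  set gm := grad (M.localPoly v (M.minus a).1) with hgm
  have key : -((K₁ ^ 2 * ‖gp‖ ^ 2 / δ + K₁ ^ 2 * ‖gm‖ ^ 2 / δ) / 2 *
      M.faceIntegral (Sum.inl a) (χ l)) ≤ M.faceEnergy (χ l) K σ v (Sum.inl a) := by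
    refine neg_mul_integral_le_faceEnergy hK hχ l v _ fun x hx => ?_
    rw [← hδ]
    set n := M.faceNormal (Sum.inl a)
    set Fp := ⟪Matrix.toEuclideanLin (K x) gp, n⟫ with hFp
    set Fm := ⟪Matrix.toEuclideanLin (K x) gm, n⟫ with hFm
    have hFpb : Fp ^ 2 ≤ K₁ ^ 2 * ‖gp‖ ^ 2 := (hK.bounds hD hx gp).2 _ (M.norm_faceNormal _)
    have hFmb : Fm ^ 2 ≤ K₁ ^ 2 * ‖gm‖ ^ 2 := (hK.bounds hD hx gm).2 _ (M.norm_faceNormal _)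
    set s := M.jump v (Sum.inl a) x
    have havg : M.avgFlux (χ l) K v (Sum.inl a) x = 1 / 2 * (χ l x * Fp + χ l x * Fm) := rfl
    rw [havg]
    -- half of the penalty absorbs the flux from each side
    have hsq : 0 ≤ δ * s * s - (Fp + Fm) * s + (Fp ^ 2 / δ + Fm ^ 2 / δ) / 2 := by
      have : δ * s * s - (Fp + Fm) * s + (Fp ^ 2 / δ + Fm ^ 2 / δ) / 2 =
          δ / 2 * (s - Fp / δ) ^ 2 + δ / 2 * (s - Fm / δ) ^ 2 := by field_simp; ring
      rw [this]; positivity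
    have hlep : Fp ^ 2 / δ ≤ K₁ ^ 2 * ‖gp‖ ^ 2 / δ := by gcongr
    have hlem : Fm ^ 2 / δ ≤ K₁ ^ 2 * ‖gm‖ ^ 2 / δ := by gcongr
    have := mul_nonneg (hχ.nonneg l hx)
      (by linarith : 0 ≤ δ * s * s - (Fp + Fm) * s +
        (K₁ ^ 2 * ‖gp‖ ^ 2 / δ + K₁ ^ 2 * ‖gm‖ ^ 2 / δ) / 2)
    linarith
  refine le_trans ?_ key
  have hface : M.faceIntegral (Sum.inl a) (χ l) = ∫ x in (M.elem (M.plus a).1).face (M.plus a).2,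
    χ l x ∂(Measure.euclideanHausdorffMeasure (d - 1)) := rfl
  rw [hface]
  linarith

/-- Non-negativity of the quadratic form: the energy of each face is bounded below by the shares
of its adjacent elements, and the shares of all facets add up to at most the element energy. -/
theorem splitForm_self_nonneg [NeZero d] (hD : IsOpen D) (hK : IsDiffusion D K K₀ K₁)
    (hχ : M.IsWeightPair χ) (hC : M.IsTraceConstant C)
    (hσ : C * K₁ ^ 2 * K₀⁻¹ * M.maxFaces ≤ σ) (l : Fin 2) (v : M.Vh) :
    0 ≤ M.splitForm (χ l) K σ v v := by
  have h1 := sum_facetShare_le hD hK hχ l v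
  rw [M.sum_elem_faces] at h1
  have h2 : -(∑ a, (M.facetShare (χ l) K₀ v (M.plus a) + M.facetShare (χ l) K₀ v (M.minus a)) +
      ∑ b, M.facetShare (χ l) K₀ v (M.bdry b)) ≤ ∑ e, M.faceEnergy (χ l) K σ v e := by
    rw [Fintype.sum_sum_type, neg_add, ← Finset.sum_neg_distrib, ← Finset.sum_neg_distrib]
    exact add_le_add (Finset.sum_le_sum fun a _ => faceEnergy_int_ge hD hK hχ hC hσ l v a)
      (Finset.sum_le_sum fun b _ => faceEnergy_bdry_ge hD hK hχ hC hσ l v b)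
  rw [splitForm_self (hχ.continuousOn l) hK]
  linarith

end Coercivity

end Mesh

end SplitDG

theorem mainTheorem6 {d : ℕ} [NeZero d] {D : Set (SplitDG.E d)} (hDopen : IsOpen D)
    (hDconvex : Convex ℝ D) {I : Type*} (M : I → SplitDG.Mesh D)
    (hM : SplitDG.ShapeRegular M) :
    (∃ C : ℝ, ∀ h : I, (M h).IsTraceConstant C) ∧
    ∀ (h : I) (C : ℝ), (M h).IsTraceConstant C →
      ∀ (K : SplitDG.E d → Matrix (Fin d) (Fin d) ℝ) (K₀ K₁ : ℝ), SplitDG.IsDiffusion D K K₀ K₁ →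
      ∀ χ : Fin 2 → SplitDG.E d → ℝ, (M h).IsWeightPair χ →
      ∀ σ : ℝ, C * K₁ ^ 2 * K₀⁻¹ * (M h).maxFaces ≤ σ →
      ∀ l : Fin 2,
        (∃! A : (M h).Vh →ₗ[ℝ] (M h).Vh, (M h).IsSplitOperator (χ l) K σ A) ∧
        ∀ A : (M h).Vh →ₗ[ℝ] (M h).Vh, (M h).IsSplitOperator (χ l) K σ A →
          ∀ v : (M h).Vh, 0 ≤ ⟪A v, v⟫ := by
  refine ⟨hM.exists_isTraceConstant, fun h C hC K K₀ K₁ hK χ hχ σ hσ l => ⟨?_, fun A hA v => ?_⟩⟩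
  · exact SplitDG.Mesh.existsUnique_isSplitOperator hDopen (hχ.continuousOn l) hK σ
  · rw [hA v v]
    exact SplitDG.Mesh.splitForm_self_nonneg hDopen hK hχ hC hσ l v
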